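/- Let $A$ be a set, $\theta\subset A\times A$ an irreflexive symmetric relation, and $\mathbb M=\mathbb M(A,\theta)=\langle A\mid ab=ba,\ (a,b)\in\theta\rangle_{Mon}$. For $t\in\mathbb M$ let $\mathrm{Alph}(t)$ be the set of letters occurring in $t$; for $X\subset\mathbb M$ let $\langle X\rangle$ be the submonoid generated by $X$ and $\theta_X=\{(x,y)\in X^2\mid \mathrm{Alph}(x)\times\mathrm{Alph}(y)\subset\theta\}$. Call $X$ a partially commutative code if the natural morphism $\mathbb M(X,\theta_X)\to\langle X\rangle$ is an isomorphism; then $\langle X\rangle$ is identified with $\mathbb M(X,\theta_X)$. Transitive bisections. Let $X$ be a partially commutative code, $B\subset X$ (possibly $B=\emptyset$ or $B=X$) and $Z=X\setminus B$. Put $\beta_Z(B)=\{zw\mid z\in Z,\ w\in\langle B\rangle,\ IA(zw)=\{z\}\}$, where $IA(t)=\{x\in X\mid t\in x\langle X\rangle\}$. If $\beta_Z(B)$ is a partially commutative code, then $B$ is called a transitively factorizing subalphabet of $X$ and $(B,\beta_Z(B))$ a transitive bisection of $\mathbb M(X,\theta_X)$; one has $\langle X\rangle=\langle B\rangle\langle\beta_Z(B)\rangle$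 with unique decomposition. Factorizations. A family $(M_j)_{j\in J}$ of submonoids of a monoid $N$, indexed by a totally ordered set $J$, is a factorization of $N$ if every $m\in N\setminus\{1\}$ has a unique decomposition $m=m_{j_1}\cdots m_{j_n}$ with $j_1>\cdots>j_n$ and $m_{j_k}\in M_{j_k}\setminus\{1\}$. For $N\subset\mathbb M$ a factorization of $N$ with components $\langle Y_j\rangle$, where the $Y_j$ are partially commutative codes, is written $(Y_j)_{j\in J}$. For factorizations of one and the same monoid, $(M_i)_{i\in J}\preceq(M'_j)_{j\in J'}$ means that $J'$ is the ordered sum of non-empty intervals $J_i$ ($i\in J$) such that $(M'_j)_{j\in J_i}$ is a factorization of $M_i$ for each $i\in J$. For a submonoid $N'$ the restriction of $(M'_j)_{j\in J'}$ to $N'$ is the subfamily of those $M'_j$ with $M'_j\subset N'$. A (finite) transitive factorization of $\mathbb M(X,\theta_X)$ is a factorization $(Y_j)_{j\in J}$ of it, $J$ finite, whose components, listed in the order of the product (that is, by decreasing index), form a sequence obtained from the one-term sequence $(X)$ by finitely many (possibly zero) steps, each of which replaces one term $Y$ of the sequence by the two terms $B,\ \beta_{Y\setminus B}(B)$ for some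 transitive bisection $(B,\beta_{Y\setminus B}(B))$ of $\mathbb M(Y,\theta_Y)$. Theorem. Let $\mathcal F=(Y_i)_{i\in J}\preceq\mathcal F'=(Y'_j)_{j\in J'}$ be two finite transitive factorizations of $\mathbb M(A,\theta)$. Then for each $i\in J$, $Y_i$ is a partially commutative code and the restriction of $\mathcal F'$ to $\langle Y_i\rangle=\mathbb M(Y_i,\theta_{Y_i})$ is a finite transitive factorization of $\mathbb M(Y_i,\theta_{Y_i})$. -/

import Mathlib

/-! ### Free partially commutative monoids -/

/-- The defining relations `ab = ba`, `(a, b) ∈ θ`. -/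
def traceRel {A : Type*} (θ : A → A → Prop) (u v : FreeMonoid A) : Prop :=
  ∃ a b : A, θ a b ∧ u = FreeMonoid.of a * FreeMonoid.of b ∧
    v = FreeMonoid.of b * FreeMonoid.of a

/-- The free partially commutative monoid `M(A, θ) = ⟨A | ab = ba, (a, b) ∈ θ⟩`. -/
abbrev TraceMonoid {A : Type*} (θ : A → A → Prop) : Type _ :=
  PresentedMonoid (traceRel θ)

namespace TraceMonoid

variable {A : Type*} {θ : A → A → Prop}

/-- The alphabet `A`, seen as a subset of `M(A, θ)`. -/
def letters (θ : A → A → Prop) : Set (TraceMonoid θ) :=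
  Set.range (PresentedMonoid.of (traceRel θ))

/-- `Alph(t)`: the set of the letters that occur in the trace `t`. -/
def alph (t : TraceMonoid θ) : Set A :=
  {a | ∃ u v : TraceMonoid θ, t = u * PresentedMonoid.of (traceRel θ) a * v}

/-- The independence relation `θ_X` on a subset `X` of `M(A, θ)`:
`(x, y) ∈ θ_X` if and only if `Alph(x) × Alph(y) ⊆ θ`. -/
def indep (X : Set (TraceMonoid θ)) (x y : X) : Prop :=
  ∀ a ∈ alph x.1, ∀ b ∈ alph y.1, θ a b

/-- `X` is a partially commutative code: a trace of `⟨X⟩` has only one decomposition over `X`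
up to the commutations of `θ_X`. In other words the natural morphism `M(X, θ_X) → ⟨X⟩` is
injective, so that `⟨X⟩` is identified with `M(X, θ_X)`. -/
def IsPCCode (X : Set (TraceMonoid θ)) : Prop :=
  ∀ u v : FreeMonoid X,
    FreeMonoid.lift (fun x : X => x.1) u = FreeMonoid.lift (fun x : X => x.1) v →
      PresentedMonoid.mk (traceRel (indep X)) u = PresentedMonoid.mk (traceRel (indep X)) v

/-! In the next three definitions `X` is the alphabet of the monoid `⟨X⟩ = M(X, θ_X)`; the case of
`M(A, θ)` itself is `X = letters θ`. -/

/-- `IA(t)` with respect to the alphabet `X`: the letters `x ∈ X` with `t = xw`, `w ∈ ⟨X⟩`. -/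
def initialAlph (X : Set (TraceMonoid θ)) (t : TraceMonoid θ) : Set (TraceMonoid θ) :=
  {x | x ∈ X ∧ ∃ w ∈ Submonoid.closure X, t = x * w}

/-- `β_Z(B) = {zw | z ∈ Z, w ∈ ⟨B⟩, IA(zw) = {z}}`, where `Z = X - B`. -/
def beta (X B : Set (TraceMonoid θ)) : Set (TraceMonoid θ) :=
  {t | ∃ z ∈ X \ B, ∃ w ∈ Submonoid.closure B, t = z * w ∧ initialAlph X t = {z}}

/-- `B` is a transitively factorizing subalphabet of the alphabet `X`. The pair
`(B, beta X B)` is then a transitive bisection of `⟨X⟩ = M(X, θ_X)`. -/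
def IsTFSA (X B : Set (TraceMonoid θ)) : Prop :=
  B ⊆ X ∧ IsPCCode (beta X B)

end TraceMonoid

/-! ### Factorizations of monoids -/

section Factorization

variable {M : Type*} [Monoid M]

/-- `l = [(i₁, m₁), …, (iₙ, mₙ)]` is a decomposition `m = m₁ ⋯ mₙ` with `i₁ > ⋯ > iₙ` and
`m_k ∈ F_{i_k} - {1}` for each `k`. -/
def IsDecomposition {J : Type*} [LinearOrder J] (F : J → Submonoid M) (m : M)
    (l : List (J × M)) : Prop :=
  l.Pairwise (fun p q => p.1 > q.1) ∧ (∀ p ∈ l, p.2 ∈ F p.1 ∧ p.2 ≠ 1) ∧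
    (l.map Prod.snd).prod = m

/-- The ordered family `(F_i)_{i ∈ J}` is a factorization of the (sub)monoid `N`. -/
def IsFactorization {J : Type*} [LinearOrder J] (N : Submonoid M) (F : J → Submonoid M) : Prop :=
  (∀ i, F i ≤ N) ∧ ∀ m ∈ N, m ≠ 1 → ∃! l : List (J × M), IsDecomposition F m l

/-- `F ≼ F'`: the index set of `F'` is an ordered sum of (non-empty) intervals
`J_i = φ⁻¹(i)`, `i ∈ J`, such that `(F'_j)_{j ∈ J_i}` is a factorization of `F_i`. -/
def IsRefinedBy {J J' : Type*} [LinearOrder J] [LinearOrder J']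
    (F : J → Submonoid M) (F' : J' → Submonoid M) : Prop :=
  ∃ φ : J' → J, Monotone φ ∧ Function.Surjective φ ∧
    ∀ i, IsFactorization (F i) (fun j : {j : J' // φ j = i} => F' j.1)

end Factorization

/-! ### Transitive factorizations -/

namespace TraceMonoid

variable {A : Type*} {θ : A → A → Prop}

/-- The finite sequences that arise from the one-term sequence `(X)` by composition with finitely
many transitive bisections: each step replaces one term `Y` by `(B, β_{Y - B}(B))`. The sequences
are written in the order of the product, as in `⟨Y⟩ = ⟨B⟩⟨β_{Y - B}(B)⟩`. -/
inductive IsTransitiveSeq (X : Set (TraceMonoid θ)) : List (Set (TraceMonoid θ)) → Prop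
  | single : IsTransitiveSeq X [X]
  | comp (l₁ l₂ : List (Set (TraceMonoid θ))) (Y B : Set (TraceMonoid θ)) :
      IsTransitiveSeq X (l₁ ++ Y :: l₂) → IsTFSA Y B →
        IsTransitiveSeq X (l₁ ++ B :: beta Y B :: l₂)

/-- `X` is a partially commutative code and `(Y_j)_{j ∈ J}`, where `Y_j` stands for the component
`⟨Y_j⟩`, is a (finite) transitive factorization of `⟨X⟩ = M(X, θ_X)`. As a factorization
multiplies its components by decreasing index, the index set `J` is identified with the
positions of the sequence in reverse order; in particular `J` is finite. -/
def IsTransitiveFactorization {J : Type*} [LinearOrder J]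
    (X : Set (TraceMonoid θ)) (Y : J → Set (TraceMonoid θ)) : Prop :=
  IsPCCode X ∧ IsFactorization (Submonoid.closure X) (fun j => Submonoid.closure (Y j)) ∧
    ∃ l : List (Set (TraceMonoid θ)), IsTransitiveSeq X l ∧
      ∃ e : (Fin l.length)ᵒᵈ ≃o J, ∀ k : Fin l.length, Y (e (OrderDual.toDual k)) = l.get k

/-- The index set `{k | ⟨Y_k⟩ ⊆ N}` of the restriction `F|_N` of `F = (Y_k)_{k ∈ J}`. -/
abbrev RestrictIndex {J : Type*} (Y : J → Set (TraceMonoid θ))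
    (N : Submonoid (TraceMonoid θ)) : Type _ :=
  {k : J // Submonoid.closure (Y k) ≤ N}

/-- The restriction `F|_N` of `F = (Y_k)_{k ∈ J}` to the submonoid `N`. -/
def restrict {J : Type*} (Y : J → Set (TraceMonoid θ)) (N : Submonoid (TraceMonoid θ)) :
    RestrictIndex Y N → Set (TraceMonoid θ) :=
  fun k => Y k.1

end TraceMonoid

/-! A transitive factorization is the list of leaves of a binary tree whose nodes are transitive
bisections (`IsBisectionTree`). Everything rests on an intrinsic description of ⟨β_{X-B}(B)⟩: it
consists of the traces of ⟨X⟩ without initial letter in B (`mem_closure_beta_iff`), and β_{X-B}(B)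
is its set of irreducible elements. Hence elimination is transitive: for B ⊆ C ⊆ X, eliminating B
and then β_{C-B}(B) amounts to eliminating C (`beta_beta`).

Trees can therefore be re-rooted. Cut the leaves into two nonempty segments, the first with product
⟨B⟩ for a bisection (B, β_{X-B}(B)). The cut lies between the two subtrees of the root or inside one
of them; recursion and `beta_beta` regroup the pieces into a tree over B and a tree over β_{X-B}(B)
(`split`). Splitting the fine tree along every node of the coarse one (`forall₂_of_flatten`) gives a
tree over each Y_i.

The restriction to ⟨Y_i⟩ can exceed the block J_i only by indices with empty alphabet, and trivial
bisections insert these (`insert_empty`). -/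

namespace TraceMonoid

/-! ### Words modulo commutation and Levi's lemma -/

section Words

variable {α : Type*} {ρ : α → α → Prop}

theorem perm_of_mk_eq {u v : FreeMonoid α}
    (h : PresentedMonoid.mk (traceRel ρ) u = PresentedMonoid.mk (traceRel ρ) v) :
    u.toList.Perm v.toList := by
  have h' : ConGen.Rel (traceRel ρ) u v := PresentedMonoid.mk_eq_mk_iff.1 h
  clear h
  induction h' with
  | of x y h =>
    obtain ⟨a, b, -, rfl, rfl⟩ := h
    exact List.Perm.swap b a []
  | refl => exact List.Perm.refl _
  | symm _ ih => exact ih.symm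
  | trans _ _ ih₁ ih₂ => exact ih₁.trans ih₂
  | mul _ _ ih₁ ih₂ => exact ih₁.append ih₂

/-- `t` is the trace left when an occurrence of the letter `y` that can be moved to the front of
the word `w` is erased. -/
def IsResidual (ρ : α → α → Prop) (y : α) (w : FreeMonoid α) (t : TraceMonoid ρ) : Prop :=
  ∃ p q : FreeMonoid α, w = p * (FreeMonoid.of y * q) ∧ (∀ a ∈ p.toList, ρ y a) ∧
    t = PresentedMonoid.mk (traceRel ρ) (p * q)

theorem isResidual_mul {y : α} {w₁ w₂ : FreeMonoid α} {t : TraceMonoid ρ} :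
    IsResidual ρ y (w₁ * w₂) t ↔
      (∃ s, IsResidual ρ y w₁ s ∧ t = s * PresentedMonoid.mk (traceRel ρ) w₂) ∨
      ((∀ a ∈ w₁.toList, ρ y a) ∧
        ∃ s, IsResidual ρ y w₂ s ∧ t = PresentedMonoid.mk (traceRel ρ) w₁ * s) := by
  constructor
  · rintro ⟨p, q, h, hp, rfl⟩
    have h' : w₁.toList ++ w₂.toList = p.toList ++ (y :: q.toList) := h
    rcases List.append_eq_append_iff.1 h' with ⟨as, h₁, h₂⟩ | ⟨bs, h₁, h₂⟩
    · right
      have hpe : p = w₁ * FreeMonoid.ofList as := h₁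
      refine ⟨fun a ha => hp a (by rw [h₁]; exact List.mem_append_left _ ha), _,
        ⟨FreeMonoid.ofList as, q, h₂, fun a ha => hp a (by
          rw [h₁]; exact List.mem_append_right _ ha), rfl⟩, ?_⟩
      rw [← map_mul, hpe, mul_assoc]
    · cases bs with
      | nil =>
        right
        have hpe : w₁ = p := h₁.trans (List.append_nil _)
        subst hpe
        refine ⟨hp, _, ⟨1, q, h₂.symm, fun a ha => by simp at ha, rfl⟩, ?_⟩
        rw [one_mul, map_mul]
      | cons c bs =>
        left
        obtain ⟨rfl, h₃⟩ := List.cons.inj h₂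
        have hq : q = FreeMonoid.ofList bs * w₂ := h₃
        refine ⟨_, ⟨p, FreeMonoid.ofList bs, h₁, hp, rfl⟩, ?_⟩
        rw [← map_mul, hq, mul_assoc]
  · rintro (⟨s, ⟨p, q, rfl, hp, rfl⟩, rfl⟩ | ⟨h, s, ⟨p, q, rfl, hp, rfl⟩, rfl⟩)
    · exact ⟨p, q * w₂, by simp only [mul_assoc], hp, by rw [← map_mul, mul_assoc]⟩
    · refine ⟨w₁ * p, q, by simp only [mul_assoc], ?_, by rw [← map_mul, mul_assoc]⟩
      intro a ha
      rcases List.mem_append.1 ha with ha | ha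
      exacts [h a ha, hp a ha]

theorem isResidual_of {y a : α} {t : TraceMonoid ρ} :
    IsResidual ρ y (FreeMonoid.of a) t ↔ y = a ∧ t = 1 := by
  constructor
  · rintro ⟨p, q, h, -, rfl⟩
    have h' : [a] = p.toList ++ (y :: q.toList) := h
    rcases List.append_eq_singleton_iff.1 h'.symm with ⟨hp, hq⟩ | ⟨hp, hq⟩
    · obtain ⟨rfl, hq'⟩ := List.cons.inj hq
      have hp' : p = 1 := hp
      have hq' : q = 1 := hq'
      simp [hp', hq']
    · simp at hq
  · rintro ⟨rfl, rfl⟩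
    exact ⟨1, 1, rfl, fun a ha => by simp at ha, by simp⟩

/-- It suffices to treat the generators ab = ba and products of congruent words. For products,
`isResidual_mul` depends on the first word only through its trace, its residuals and its set of
letters, all of which are invariant. -/
theorem isResidual_congr (hρ : ∀ a b, ρ a b → ρ b a) {y : α} {u v : FreeMonoid α}
    (h : PresentedMonoid.mk (traceRel ρ) u = PresentedMonoid.mk (traceRel ρ) v)
    (t : TraceMonoid ρ) : IsResidual ρ y u t ↔ IsResidual ρ y v t := by
  have h' : ConGen.Rel (traceRel ρ) u v := PresentedMonoid.mk_eq_mk_iff.1 h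
  clear h
  induction h' generalizing t with
  | of x z h =>
    obtain ⟨a, b, hab, rfl, rfl⟩ := h
    simp only [isResidual_mul, isResidual_of, FreeMonoid.toList_of, List.mem_singleton]
    constructor
    · rintro (⟨s, ⟨rfl, rfl⟩, rfl⟩ | ⟨-, s, ⟨rfl, rfl⟩, rfl⟩)
      · exact Or.inr ⟨by rintro _ rfl; exact hab, 1, ⟨rfl, rfl⟩, by simp⟩
      · exact Or.inl ⟨1, ⟨rfl, rfl⟩, by simp⟩
    · rintro (⟨s, ⟨rfl, rfl⟩, rfl⟩ | ⟨-, s, ⟨rfl, rfl⟩, rfl⟩)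
      · exact Or.inr ⟨by rintro _ rfl; exact hρ _ _ hab, 1, ⟨rfl, rfl⟩, by simp⟩
      · exact Or.inl ⟨1, ⟨rfl, rfl⟩, by simp⟩
  | refl => exact Iff.rfl
  | symm _ ih => exact (ih t).symm
  | trans _ _ ih₁ ih₂ => exact (ih₁ t).trans (ih₂ t)
  | @mul w x z z' h₁ h₂ ih₁ ih₂ =>
    have e₁ := PresentedMonoid.mk_eq_mk_iff.2 (show conGen (traceRel ρ) w x from h₁)
    have e₂ := PresentedMonoid.mk_eq_mk_iff.2 (show conGen (traceRel ρ) z z' from h₂)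
    have hm : ∀ a, a ∈ w.toList ↔ a ∈ x.toList := fun a => (perm_of_mk_eq e₁).mem_iff
    simp only [isResidual_mul, ih₁, ih₂, e₁, e₂, hm]

/-- Levi's lemma for two distinct letters at the front of a trace. -/
theorem exists_of_mk_of_mul_eq (hρ : ∀ a b, ρ a b → ρ b a) {y z : α} (hyz : y ≠ z)
    {u b : FreeMonoid α}
    (h : PresentedMonoid.mk (traceRel ρ) (FreeMonoid.of y * u) =
      PresentedMonoid.mk (traceRel ρ) (FreeMonoid.of z * b)) :
    ρ y z ∧ ∃ b' : FreeMonoid α, PresentedMonoid.mk (traceRel ρ) b =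
      PresentedMonoid.mk (traceRel ρ) (FreeMonoid.of y * b') := by
  -- Follow the leading y into the word zb: as y ≠ z, it reappears in b, preceded only by letters
  -- independent of y.
  have h₁ : IsResidual ρ y (FreeMonoid.of y * u) (PresentedMonoid.mk (traceRel ρ) u) :=
    ⟨1, u, rfl, fun a ha => by simp at ha, by simp⟩
  rw [isResidual_congr hρ h, isResidual_mul] at h₁
  rcases h₁ with ⟨s, hs, -⟩ | ⟨hz, s, ⟨p, q, rfl, hp, rfl⟩, -⟩
  · exact absurd (isResidual_of.1 hs).1 hyz
  · refine ⟨hz z (by simp), p * q, ?_⟩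
    have key : ∀ p : FreeMonoid α, (∀ a ∈ p.toList, ρ y a) →
        PresentedMonoid.mk (traceRel ρ) (p * FreeMonoid.of y) =
          PresentedMonoid.mk (traceRel ρ) (FreeMonoid.of y * p) := by
      intro p
      induction p using FreeMonoid.inductionOn' with
      | one => simp
      | of_mul a p ih =>
        intro hp
        rw [FreeMonoid.toList_of_mul, List.forall_mem_cons] at hp
        have hc : PresentedMonoid.mk (traceRel ρ) (FreeMonoid.of y * FreeMonoid.of a) =
            PresentedMonoid.mk (traceRel ρ) (FreeMonoid.of a * FreeMonoid.of y) :=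
          PresentedMonoid.mk_eq_mk_of_rel ⟨y, a, hp.1, rfl, rfl⟩
        rw [mul_assoc, map_mul, ih hp.2, ← mul_assoc (FreeMonoid.of y),
          map_mul _ (FreeMonoid.of y * _), hc, ← map_mul, ← map_mul, mul_assoc]
    rw [← mul_assoc, ← mul_assoc, map_mul, key p hp, ← map_mul]

end Words

/-! ### Partially commutative codes -/

variable {A : Type*} {θ : A → A → Prop}

theorem commute_of_indep {X : Set (TraceMonoid θ)} {x y : X} (h : indep X x y) :
    Commute x.1 y.1 := by
  have key : ∀ t : TraceMonoid θ, ∃ l : List A,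
      t = (l.map (PresentedMonoid.of (traceRel θ))).prod ∧ ∀ a ∈ l, a ∈ alph t := by
    intro t
    obtain ⟨w, rfl⟩ := PresentedMonoid.surjective_mk t
    have hw : ∀ w : FreeMonoid A, PresentedMonoid.mk (traceRel θ) w =
        (w.toList.map (PresentedMonoid.of (traceRel θ))).prod := by
      intro w
      induction w using FreeMonoid.inductionOn' with
      | one => simp
      | of_mul a p ih => simp [ih, PresentedMonoid.of]
    refine ⟨w.toList, hw w, fun a ha => ?_⟩
    obtain ⟨p, q, hpq⟩ := List.append_of_mem ha
    refine ⟨(p.map (PresentedMonoid.of (traceRel θ))).prod,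
      (q.map (PresentedMonoid.of (traceRel θ))).prod, ?_⟩
    rw [hw w, hpq, List.map_append, List.prod_append, List.map_cons, List.prod_cons, mul_assoc]
  obtain ⟨l, hl, hla⟩ := key x.1
  obtain ⟨m, hm, hma⟩ := key y.1
  rw [hl, hm]
  apply Commute.list_prod_left
  intro s hs
  apply Commute.list_prod_right
  intro s' hs'
  obtain ⟨a, ha, rfl⟩ := List.mem_map.1 hs
  obtain ⟨b, hb, rfl⟩ := List.mem_map.1 hs'
  exact PresentedMonoid.mk_eq_mk_of_rel ⟨a, b, h a (hla a ha) b (hma b hb), rfl, rfl⟩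

theorem exists_word_of_mem_closure {X : Set (TraceMonoid θ)} {t : TraceMonoid θ}
    (ht : t ∈ Submonoid.closure X) :
    ∃ w : FreeMonoid X, FreeMonoid.lift (fun x : X => x.1) w = t := by
  obtain ⟨l, hl, rfl⟩ := Submonoid.exists_list_of_mem_closure ht
  exact ⟨FreeMonoid.ofList (l.attachWith _ hl), by
    rw [FreeMonoid.lift_ofList, List.attachWith_map_subtype_val]⟩

namespace IsPCCode

variable {X B : Set (TraceMonoid θ)}

theorem lift_eq_of_mk_eq {u v : FreeMonoid X} (h : PresentedMonoid.mk (traceRel (indep X)) u =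
    PresentedMonoid.mk (traceRel (indep X)) v) :
    FreeMonoid.lift (fun x : X => x.1) u = FreeMonoid.lift (fun x : X => x.1) v := by
  have hr : ∀ a b : FreeMonoid X, traceRel (indep X) a b →
      FreeMonoid.lift (fun x : X => x.1) a = FreeMonoid.lift (fun x : X => x.1) b := by
    rintro _ _ ⟨a, b, hab, rfl, rfl⟩
    simpa using (commute_of_indep hab).eq
  exact congrArg (PresentedMonoid.lift (fun x : X => x.1) hr) h

/-- The relations of M(X, θ_X) only permute letters, so a trace of ⟨X⟩ has a well-defined multiset
of letters over X. -/
theorem perm (hX : IsPCCode X) {l l' : List (TraceMonoid θ)} (hl : ∀ x ∈ l, x ∈ X)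
    (hl' : ∀ x ∈ l', x ∈ X) (h : l.prod = l'.prod) : l.Perm l' := by
  have := perm_of_mk_eq (hX (FreeMonoid.ofList (l.attachWith _ hl))
    (FreeMonoid.ofList (l'.attachWith _ hl')) (by
      simpa [FreeMonoid.lift_ofList, List.attachWith_map_subtype_val] using h))
  simpa [List.attachWith_map_subtype_val] using this.map Subtype.val

theorem mono (hX : IsPCCode X) (hB : B ⊆ X) : IsPCCode B := by
  classical
  intro u v h
  have h₁ := hX (FreeMonoid.map (Set.inclusion hB) u) (FreeMonoid.map (Set.inclusion hB) v) (by
    simpa [FreeMonoid.lift_apply, Function.comp_def] using h)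
  -- Erasing the letters outside B respects the commutations and is a left inverse of M(B, θ_B) →
  -- M(X, θ_X).
  let f : X → TraceMonoid (indep B) := fun x =>
    if hx : x.1 ∈ B then PresentedMonoid.of _ ⟨x.1, hx⟩ else 1
  have hf : ∀ a b : FreeMonoid X, traceRel (indep X) a b →
      FreeMonoid.lift f a = FreeMonoid.lift f b := by
    rintro _ _ ⟨a, b, hab, rfl, rfl⟩
    simp only [map_mul, FreeMonoid.lift_eval_of, f]
    split_ifs with h₁ h₂
    · exact PresentedMonoid.mk_eq_mk_of_rel ⟨⟨a.1, h₁⟩, ⟨b.1, h₂⟩, hab, rfl, rfl⟩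
    all_goals simp
  have h₂ : FreeMonoid.lift f (FreeMonoid.map (Set.inclusion hB) u) =
      FreeMonoid.lift f (FreeMonoid.map (Set.inclusion hB) v) :=
    congrArg (PresentedMonoid.lift f hf) h₁
  have h₃ : (FreeMonoid.lift f).comp (FreeMonoid.map (Set.inclusion hB)) =
      PresentedMonoid.mk (traceRel (indep B)) := by
    apply FreeMonoid.hom_eq
    intro x
    simp [f, PresentedMonoid.of]
  have h₄ := fun w => DFunLike.congr_fun h₃ w
  rw [← h₄, ← h₄]
  exact h₂

theorem levi (hθ : ∀ a b, θ a b → θ b a) (hX : IsPCCode X) {y z u b : TraceMonoid θ}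
    (hy : y ∈ X) (hz : z ∈ X) (hu : u ∈ Submonoid.closure X) (hb : b ∈ Submonoid.closure X)
    (h : y * u = z * b) (hyz : y ≠ z) :
    y * z = z * y ∧ ∃ b' ∈ Submonoid.closure X, b = y * b' := by
  obtain ⟨u, rfl⟩ := exists_word_of_mem_closure hu
  obtain ⟨b, rfl⟩ := exists_word_of_mem_closure hb
  have h₁ := hX (FreeMonoid.of ⟨y, hy⟩ * u) (FreeMonoid.of ⟨z, hz⟩ * b) (by simpa using h)
  obtain ⟨h₂, b', h₃⟩ := exists_of_mk_of_mul_eq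
    (fun a b (hab : indep X a b) c hc d hd => hθ _ _ (hab d hd c hc))
    (fun h => hyz (congrArg Subtype.val h)) h₁
  refine ⟨commute_of_indep h₂, FreeMonoid.lift (fun x : X => x.1) b', ?_, ?_⟩
  · rw [FreeMonoid.lift_apply]
    exact Submonoid.list_prod_mem _ (by
      intro x hx
      obtain ⟨x, -, rfl⟩ := List.mem_map.1 hx
      exact Submonoid.subset_closure x.2)
  · simpa using lift_eq_of_mk_eq h₃

end IsPCCode

end TraceMonoid

theorem Submonoid.mem_of_mem_closure_of_irreducible {M : Type*} [Monoid M] {S : Set M} {s : M}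
    (hs : s ∈ Submonoid.closure S) (h₁ : s ≠ 1)
    (hirr : ∀ r ∈ Submonoid.closure S, ∀ r' ∈ Submonoid.closure S, s = r * r' → r = 1 ∨ r' = 1) :
    s ∈ S := by
  induction hs using Submonoid.closure_induction_left with
  | one => exact absurd rfl h₁
  | mul_left x hx y hy ih =>
    rcases hirr x (Submonoid.subset_closure hx) y hy rfl with rfl | rfl
    · rw [one_mul] at h₁ hirr ⊢
      exact ih h₁ hirr
    · rwa [mul_one]

/-! ### Elimination: the monoid generated by β and transitivity -/

namespace TraceMonoid

variable {A : Type*} {θ : A → A → Prop}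

/-- The traces over the alphabet `X` without initial letter in `B`. -/
def remainder (X B : Set (TraceMonoid θ)) : Set (TraceMonoid θ) :=
  {t | t ∈ Submonoid.closure X ∧ ∀ b ∈ B, ∀ u ∈ Submonoid.closure X, t ≠ b * u}

namespace IsPCCode

variable {X B C : Set (TraceMonoid θ)}

/-- By `perm`, the letters of u and v are exactly those of uv. -/
theorem mem_of_mul_mem (hX : IsPCCode X) (hB : B ⊆ X) {u v : TraceMonoid θ}
    (hu : u ∈ Submonoid.closure X) (hv : v ∈ Submonoid.closure X)
    (h : u * v ∈ Submonoid.closure B) :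
    u ∈ Submonoid.closure B ∧ v ∈ Submonoid.closure B := by
  obtain ⟨l, hl, rfl⟩ := Submonoid.exists_list_of_mem_closure hu
  obtain ⟨m, hm, rfl⟩ := Submonoid.exists_list_of_mem_closure hv
  obtain ⟨k, hk, hkp⟩ := Submonoid.exists_list_of_mem_closure h
  have hp : k.Perm (l ++ m) := hX.perm (fun x hx => hB (hk x hx))
    (fun x hx => (List.mem_append.1 hx).elim (hl x) (hm x)) (by rw [hkp, List.prod_append])
  have hb : ∀ x ∈ l ++ m, x ∈ B := fun x hx => hk x (hp.mem_iff.2 hx)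
  exact ⟨Submonoid.list_prod_mem _ fun x hx =>
      Submonoid.subset_closure (hb x (List.mem_append_left _ hx)),
    Submonoid.list_prod_mem _ fun x hx =>
      Submonoid.subset_closure (hb x (List.mem_append_right _ hx))⟩

theorem mem_of_mem_closure (hX : IsPCCode X) (hB : B ⊆ X) {x : TraceMonoid θ}
    (hx : x ∈ X) (h : x ∈ Submonoid.closure B) : x ∈ B := by
  obtain ⟨k, hk, hkp⟩ := Submonoid.exists_list_of_mem_closure h
  have hp : k.Perm [x] := hX.perm (fun x hx => hB (hk x hx)) (by simpa using hx) (by simpa using hkp)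
  exact hk x (hp.mem_iff.2 (by simp))

theorem one_notMem (hX : IsPCCode X) : (1 : TraceMonoid θ) ∉ X := fun h => by
  have := hX.perm (l := [1]) (l' := []) (by simpa using h) (by simp) (by simp)
  simp at this

theorem mul_ne_one (hX : IsPCCode X) {x u : TraceMonoid θ} (hx : x ∈ X)
    (hu : u ∈ Submonoid.closure X) : x * u ≠ 1 := fun h => by
  obtain ⟨l, hl, rfl⟩ := Submonoid.exists_list_of_mem_closure hu
  have := hX.perm (l := x :: l) (l' := []) (by simpa using ⟨hx, hl⟩) (by simp) (by simpa using h)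
  simp at this

/-- Peel off the letters of r one by one: Levi's lemma either identifies y with the current letter
or moves it past. -/
theorem initial_mul (hθ : ∀ a b, θ a b → θ b a) (hX : IsPCCode X) {y u r s : TraceMonoid θ}
    (hy : y ∈ X) (hu : u ∈ Submonoid.closure X) (hr : r ∈ Submonoid.closure X)
    (hs : s ∈ Submonoid.closure X) (h : y * u = r * s) :
    (∃ r' ∈ Submonoid.closure X, r = y * r') ∨ ∃ s' ∈ Submonoid.closure X, s = y * s' := by
  induction hr using Submonoid.closure_induction_left generalizing u with
  | one => exact Or.inr ⟨u, hu, by rw [h, one_mul]⟩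
  | mul_left z hz r hr ih =>
    by_cases hyz : y = z
    · exact Or.inl ⟨r, hr, by rw [hyz]⟩
    · obtain ⟨hc, b, hb, hbe⟩ := hX.levi hθ hy hz hu (mul_mem hr hs)
        (by rw [h, mul_assoc]) hyz
      rcases ih hb hbe.symm with ⟨r', hr', rfl⟩ | hs'
      · exact Or.inl ⟨z * r', mul_mem (Submonoid.subset_closure hz) hr', by
          rw [← mul_assoc, ← hc, mul_assoc]⟩
      · exact Or.inr hs'

theorem beta_subset_remainder (hB : B ⊆ X) : beta X B ⊆ remainder X B := by
  rintro _ ⟨z, hz, w, hw, rfl, h⟩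
  refine ⟨mul_mem (Submonoid.subset_closure hz.1) (Submonoid.closure_mono hB hw), ?_⟩
  intro b hb u hu e
  have : b ∈ initialAlph X (z * w) := ⟨hB hb, u, hu, e⟩
  rw [h, Set.mem_singleton_iff] at this
  exact hz.2 (this ▸ hb)

theorem mul_mem_remainder (hθ : ∀ a b, θ a b → θ b a) (hX : IsPCCode X) (hB : B ⊆ X)
    {r s : TraceMonoid θ} (hr : r ∈ remainder X B) (hs : s ∈ remainder X B) :
    r * s ∈ remainder X B := by
  refine ⟨mul_mem hr.1 hs.1, fun b hb u hu e => ?_⟩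
  rcases hX.initial_mul hθ (hB hb) hu hr.1 hs.1 e.symm with ⟨r', hr', h⟩ | ⟨s', hs', h⟩
  · exact hr.2 b hb r' hr' h
  · exact hs.2 b hb s' hs' h

theorem remainder_of_mul (hX : r * s ∈ remainder X B) (hr : r ∈ Submonoid.closure X)
    (hs : s ∈ Submonoid.closure X) : r ∈ remainder X B :=
  ⟨hr, fun b hb u hu e => hX.2 b hb (u * s) (mul_mem hu hs) (by rw [e, mul_assoc])⟩

theorem closure_beta_subset_remainder (hθ : ∀ a b, θ a b → θ b a) (hX : IsPCCode X)
    (hB : B ⊆ X) {t : TraceMonoid θ} (ht : t ∈ Submonoid.closure (beta X B)) :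
    t ∈ remainder X B := by
  induction ht using Submonoid.closure_induction with
  | mem x hx => exact beta_subset_remainder hB hx
  | one => exact ⟨one_mem _, fun b hb u hu e => hX.mul_ne_one (hB hb) hu e.symm⟩
  | mul x y _ _ hx hy => exact hX.mul_mem_remainder hθ hB hx hy

/-- As long as zw has an initial letter other than z, Levi's lemma extracts it from w and moves it
past z to the front. It belongs to B, and w gets shorter. -/
theorem mul_mem_closure_mul_beta (hθ : ∀ a b, θ a b → θ b a) (hX : IsPCCode X) (hB : B ⊆ X)
    {z w : TraceMonoid θ} (hz : z ∈ X \ B) (hw : w ∈ Submonoid.closure B) :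
    ∃ b ∈ Submonoid.closure B, ∃ r ∈ beta X B, z * w = b * r := by
  obtain ⟨l, hl, rfl⟩ := Submonoid.exists_list_of_mem_closure hw
  induction hn : l.length generalizing l with
  | zero =>
    obtain rfl := List.length_eq_zero_iff.1 hn
    refine ⟨1, one_mem _, z * 1, ⟨z, hz, 1, one_mem _, rfl, ?_⟩, by simp⟩
    ext x
    simp only [Set.mem_singleton_iff]
    constructor
    · rintro ⟨hx, u, hu, e⟩
      have : z * 1 ∈ Submonoid.closure {z} := by simpa using Submonoid.mem_closure_singleton_self
      rw [e] at this
      simpa using hX.mem_of_mem_closure (B := {z}) (by simpa using hz.1) hx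
        (hX.mem_of_mul_mem (by simpa using hz.1) (Submonoid.subset_closure hx) hu this).1
    · rintro rfl
      exact ⟨hz.1, 1, one_mem _, rfl⟩
  | succ n ih =>
    by_cases hI : initialAlph X (z * l.prod) = {z}
    · exact ⟨1, one_mem _, _, ⟨z, hz, l.prod, hw, rfl, hI⟩, (one_mul _).symm⟩
    have hwX := Submonoid.closure_mono hB hw
    have : ∃ y ∈ initialAlph X (z * l.prod), y ≠ z := by
      by_contra! hc
      exact hI (Set.Subset.antisymm hc (Set.singleton_subset_iff.2 ⟨hz.1, _, hwX, rfl⟩))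
    obtain ⟨y, ⟨hy, u, hu, e⟩, hyz⟩ := this
    obtain ⟨hc, b, hb, hbe⟩ := hX.levi hθ hy hz.1 hu hwX e.symm hyz
    have hm := hX.mem_of_mul_mem hB (Submonoid.subset_closure hy) hb (hbe ▸ hw)
    obtain ⟨k, hk, rfl⟩ := Submonoid.exists_list_of_mem_closure hm.2
    have hyB := hX.mem_of_mem_closure hB hy hm.1
    have hp : l.Perm (y :: k) := hX.perm (fun x hx => hB (hl x hx))
      (by simpa using ⟨hy, fun x hx => hB (hk x hx)⟩) (by simpa using hbe)
    obtain ⟨b', hb', r, hr, e'⟩ := ih k hk hm.2 (by simpa using hp.length_eq.symm.trans hn)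
    exact ⟨y * b', mul_mem hm.1 hb', r, hr, by
      rw [hbe, ← mul_assoc, ← hc, mul_assoc, e', mul_assoc]⟩

/-- The decomposition `⟨X⟩ = ⟨B⟩⟨β_{X - B}(B)⟩`. -/
theorem exists_mul_eq (hθ : ∀ a b, θ a b → θ b a) (hX : IsPCCode X) (hB : B ⊆ X)
    {t : TraceMonoid θ} (ht : t ∈ Submonoid.closure X) :
    ∃ b ∈ Submonoid.closure B, ∃ r ∈ Submonoid.closure (beta X B), b * r = t := by
  induction ht using Submonoid.closure_induction_left with
  | one => exact ⟨1, one_mem _, 1, one_mem _, one_mul _⟩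
  | mul_left x hx t _ ih =>
    obtain ⟨b, hb, r, hr, rfl⟩ := ih
    by_cases hxB : x ∈ B
    · exact ⟨x * b, mul_mem (Submonoid.subset_closure hxB) hb, r, hr, mul_assoc _ _ _⟩
    · obtain ⟨b', hb', s, hs, e⟩ := hX.mul_mem_closure_mul_beta hθ hB ⟨hx, hxB⟩ hb
      exact ⟨b', hb', s * r, mul_mem (Submonoid.subset_closure hs) hr, by
        rw [← mul_assoc, ← mul_assoc, e]⟩

/-- A nontrivial trace has an initial letter. -/
theorem eq_one_or_exists_mul {t : TraceMonoid θ} (ht : t ∈ Submonoid.closure X) :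
    t = 1 ∨ ∃ x ∈ X, ∃ u ∈ Submonoid.closure X, t = x * u := by
  induction ht using Submonoid.closure_induction_left with
  | one => exact Or.inl rfl
  | mul_left x hx t ht _ => exact Or.inr ⟨x, hx, t, ht, rfl⟩

/-- Write t = br with b ∈ ⟨B⟩ and r ∈ ⟨β⟩: unless b = 1, its first letter is an initial letter of t
in B. -/
theorem mem_closure_beta_iff (hθ : ∀ a b, θ a b → θ b a) (hX : IsPCCode X) (hB : B ⊆ X)
    {t : TraceMonoid θ} : t ∈ Submonoid.closure (beta X B) ↔ t ∈ remainder X B := by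
  refine ⟨hX.closure_beta_subset_remainder hθ hB, fun ht => ?_⟩
  obtain ⟨b, hb, r, hr, rfl⟩ := hX.exists_mul_eq hθ hB ht.1
  rcases eq_one_or_exists_mul hb with rfl | ⟨x, hx, u, hu, rfl⟩
  · rwa [one_mul]
  · exact absurd (mul_assoc _ _ _) (ht.2 x hx (u * r) (mul_mem (Submonoid.closure_mono hB hu)
      (hX.closure_beta_subset_remainder hθ hB hr).1))

/-- The trace zw has a single letter outside B, counted with multiplicity, whereas each nontrivial
factor without initial letter in B contributes at least one. -/
theorem beta_irreducible (hX : IsPCCode X) (hB : B ⊆ X) {t r s : TraceMonoid θ}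
    (ht : t ∈ beta X B) (hr : r ∈ remainder X B) (hs : s ∈ remainder X B) (h : t = r * s) :
    r = 1 ∨ s = 1 := by
  obtain ⟨z, hz, w, hw, rfl, -⟩ := ht
  obtain ⟨l, hl, rfl⟩ := Submonoid.exists_list_of_mem_closure hw
  rcases eq_one_or_exists_mul hr.1 with h₁ | ⟨x, hx, u, hu, rfl⟩
  · exact Or.inl h₁
  rcases eq_one_or_exists_mul hs.1 with h₁ | ⟨y, hy, v, hv, rfl⟩
  · exact Or.inr h₁
  exfalso
  have hxB : x ∉ B := fun hxB => hr.2 x hxB u hu rfl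
  have hyB : y ∉ B := fun hyB => hs.2 y hyB v hv rfl
  obtain ⟨m, hm, rfl⟩ := Submonoid.exists_list_of_mem_closure hu
  obtain ⟨k, hk, rfl⟩ := Submonoid.exists_list_of_mem_closure hv
  have hp : (z :: l).Perm (x :: (m ++ y :: k)) := hX.perm
    (by simpa using ⟨hz.1, fun a ha => hB (hl a ha)⟩)
    (by
      simp only [List.mem_cons, List.mem_append]
      rintro a (rfl | ha | rfl | ha)
      exacts [hx, hm a ha, hy, hk a ha])
    (by simpa [mul_assoc] using h)
  have hxz : x = z := by
    rcases List.mem_cons.1 ((hp.mem_iff (a := x)).2 (by simp)) with h | h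
    exacts [h, absurd (hl x h) hxB]
  subst hxz
  exact hyB (hl y (((List.perm_cons x).1 hp).mem_iff.2 (by simp)))

theorem beta_ne_one (hX : IsPCCode X) (hB : B ⊆ X) {t : TraceMonoid θ} (ht : t ∈ beta X B) :
    t ≠ 1 := by
  obtain ⟨z, hz, w, hw, rfl, -⟩ := ht
  exact hX.mul_ne_one hz.1 (Submonoid.closure_mono hB hw)

/-- `β_{X - B}(B)` is the set of the irreducible elements of the monoid that it generates. -/
theorem beta_subset_of_closure_eq (hθ : ∀ a b, θ a b → θ b a) (hX : IsPCCode X) (hB : B ⊆ X)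
    {S : Set (TraceMonoid θ)} (h : Submonoid.closure S = Submonoid.closure (beta X B)) :
    beta X B ⊆ S := fun t ht => by
  refine Submonoid.mem_of_mem_closure_of_irreducible (h ▸ Submonoid.subset_closure ht)
    (hX.beta_ne_one hB ht) fun r hr r' hr' e => hX.beta_irreducible hB ht ?_ ?_ e
  · exact hX.closure_beta_subset_remainder hθ hB (h ▸ hr)
  · exact hX.closure_beta_subset_remainder hθ hB (h ▸ hr')

theorem beta_empty (hθ : ∀ a b, θ a b → θ b a) (hX : IsPCCode X) : beta X ∅ = X := by
  apply Set.Subset.antisymm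
  · rintro _ ⟨z, hz, w, hw, rfl, -⟩
    obtain rfl : w = 1 := by simpa using hw
    simpa using hz.1
  · intro z hz
    obtain ⟨b, hb, r, hr, e⟩ := hX.mul_mem_closure_mul_beta hθ (Set.empty_subset X)
      (z := z) ⟨hz, Set.notMem_empty z⟩ (one_mem _)
    obtain rfl : b = 1 := by simpa using hb
    rw [mul_one, one_mul] at e
    rwa [e]

/-- Divisors in ⟨X⟩ of a trace of ⟨C⟩ lie in ⟨C⟩, so its initial letters over X and over C agree. -/
theorem beta_subset_beta (hX : IsPCCode X) (hC : C ⊆ X) : beta C B ⊆ beta X B := by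
  rintro _ ⟨z, hz, w, hw, rfl, h⟩
  refine ⟨z, ⟨hC hz.1, hz.2⟩, w, hw, rfl, Set.Subset.antisymm ?_ ?_⟩
  · have hzw : z * w ∈ Submonoid.closure C := by
      have : z ∈ initialAlph C (z * w) := h ▸ rfl
      obtain ⟨-, u, hu, e⟩ := this
      rw [e]
      exact mul_mem (Submonoid.subset_closure hz.1) hu
    rintro x ⟨hx, u, hu, e⟩
    have hm := hX.mem_of_mul_mem hC (Submonoid.subset_closure hx) hu (e ▸ hzw)
    rw [← h]
    exact ⟨hX.mem_of_mem_closure hC hx hm.1, u, hm.2, e⟩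
  · have : z ∈ initialAlph C (z * w) := h ▸ rfl
    obtain ⟨-, u, hu, e⟩ := this
    exact Set.singleton_subset_iff.2 ⟨hC hz.1, u, Submonoid.closure_mono hC hu, e⟩

theorem remainder_eq_inter (hX : IsPCCode X) (hC : C ⊆ X) (hB : B ⊆ C) {t : TraceMonoid θ} :
    t ∈ remainder C B ↔ t ∈ remainder X B ∧ t ∈ Submonoid.closure C := by
  constructor
  · rintro ⟨ht, h⟩
    exact ⟨⟨Submonoid.closure_mono hC ht, fun b hb u hu e => h b hb u
      (hX.mem_of_mul_mem hC (Submonoid.subset_closure (hC (hB hb))) hu (e ▸ ht)).2 e⟩, ht⟩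
  · rintro ⟨⟨-, h⟩, ht⟩
    exact ⟨ht, fun b hb u hu e => h b hb u (Submonoid.closure_mono hC hu) e⟩

/-- Transitivity of the elimination: eliminating `B` and then `β_{C - B}(B)` amounts to
eliminating `C`. -/
theorem beta_beta (hθ : ∀ a b, θ a b → θ b a) (hX : IsPCCode X) (hC : C ⊆ X) (hB : B ⊆ C)
    (hβ : IsPCCode (beta X B)) : beta (beta X B) (beta C B) = beta X C := by
  have hBX := hB.trans hC
  have hCc := hX.mono hC
  have hβs : beta C B ⊆ beta X B := hX.beta_subset_beta hC
  -- Equality of the generated monoids is enough, since both sets consist of the irreducible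
  -- elements.
  have hcl : Submonoid.closure (beta (beta X B) (beta C B)) = Submonoid.closure (beta X C) := by
    ext t
    rw [hβ.mem_closure_beta_iff hθ hβs, hX.mem_closure_beta_iff hθ hC]
    constructor
    · rintro ⟨ht, h⟩
      have htX := ((hX.mem_closure_beta_iff hθ hBX).1 ht)
      -- The ⟨C⟩-part s of t has no initial letter in B, so it lies in ⟨β_{C-B}(B)⟩; by hypothesis t
      -- has no initial letter there, whence s = 1.
      obtain ⟨s, hs, r, hr, rfl⟩ := hX.exists_mul_eq hθ hC htX.1
      have hr' := (hX.mem_closure_beta_iff hθ hC).1 hr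
      have hsr := remainder_of_mul htX (Submonoid.closure_mono hC hs) hr'.1
      have hs' : s ∈ Submonoid.closure (beta C B) := (hCc.mem_closure_beta_iff hθ hB).2
        ((hX.remainder_eq_inter hC hB).2 ⟨hsr, hs⟩)
      rcases eq_one_or_exists_mul hs' with rfl | ⟨d, hd, u, hu, rfl⟩
      · rwa [one_mul]
      · exact absurd (mul_assoc _ _ _) (h d hd (u * r) (mul_mem (Submonoid.closure_mono hβs hu)
          ((hX.mem_closure_beta_iff hθ hBX).2 ⟨hr'.1, fun b hb => hr'.2 b (hB hb)⟩)))
    · rintro ⟨ht, h⟩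
      have htB : ∀ t ∈ Submonoid.closure (beta X B), t ∈ Submonoid.closure X := fun t ht =>
        ((hX.mem_closure_beta_iff hθ hBX).1 ht).1
      refine ⟨(hX.mem_closure_beta_iff hθ hBX).2 ⟨ht, fun b hb => h b (hB hb)⟩, ?_⟩
      rintro _ ⟨z, hz, w, hw, rfl, -⟩ u hu e
      exact h z hz.1 (w * u) (mul_mem (Submonoid.closure_mono hBX hw) (htB u hu))
        (by rw [e, mul_assoc])
  exact Set.Subset.antisymm (hβ.beta_subset_of_closure_eq hθ hβs hcl.symm)
    (hX.beta_subset_of_closure_eq hθ hC hcl)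

end IsPCCode

end TraceMonoid

/-! ### Trees of bisections -/

open scoped Pointwise

namespace TraceMonoid

variable {A : Type*} {θ : A → A → Prop}

theorem beta_self (X : Set (TraceMonoid θ)) : beta X X = ∅ := by
  ext t
  simp [beta]

/-- The set product of the monoids generated by the terms of a sequence of alphabets. -/
def closureProd (l : List (Set (TraceMonoid θ))) : Set (TraceMonoid θ) :=
  (l.map fun Y => (Submonoid.closure Y : Set (TraceMonoid θ))).prod

theorem closureProd_append (l m : List (Set (TraceMonoid θ))) :
    closureProd (l ++ m) = closureProd l * closureProd m := by
  simp [closureProd]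

theorem closureProd_singleton (Y : Set (TraceMonoid θ)) :
    closureProd [Y] = Submonoid.closure Y := by
  simp [closureProd]

theorem one_mem_closureProd (l : List (Set (TraceMonoid θ))) :
    (1 : TraceMonoid θ) ∈ closureProd l := by
  induction l with
  | nil => simp [closureProd]
  | cons Y l ih =>
    exact Set.mem_mul.2 ⟨1, one_mem _, 1, ih, one_mul 1⟩

/-- The sequences of alphabets that are read off the leaves of a binary tree of transitive
bisections with root `X`. -/
inductive IsBisectionTree : Set (TraceMonoid θ) → List (Set (TraceMonoid θ)) → Prop
  | leaf (X : Set (TraceMonoid θ)) : IsBisectionTree X [X]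
  | node (X B : Set (TraceMonoid θ)) (l m : List (Set (TraceMonoid θ))) :
      IsTFSA X B → IsBisectionTree B l → IsBisectionTree (beta X B) m → IsBisectionTree X (l ++ m)

namespace IsBisectionTree

variable {X : Set (TraceMonoid θ)} {l : List (Set (TraceMonoid θ))}

theorem ne_nil (h : IsBisectionTree X l) : l ≠ [] := by
  induction h with
  | leaf => simp
  | node _ _ _ _ _ _ _ ih _ => simp [ih]

/-- The bisected leaf belongs to one of the two subtrees and the bisection is grafted there. -/
theorem replace (h : IsBisectionTree X l) {l₁ l₂ : List (Set (TraceMonoid θ))}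
    {Y B : Set (TraceMonoid θ)} (hl : l = l₁ ++ Y :: l₂) (hB : IsTFSA Y B) :
    IsBisectionTree X (l₁ ++ B :: beta Y B :: l₂) := by
  induction h generalizing l₁ l₂ with
  | leaf X =>
    rcases List.append_eq_singleton_iff.1 hl.symm with ⟨rfl, h⟩ | ⟨-, h⟩
    · obtain ⟨rfl, rfl⟩ := List.cons.inj h
      exact node _ B [B] [beta _ B] hB (leaf _) (leaf _)
    · simp at h
  | node X C l m hC hl₁ hl₂ ih₁ ih₂ =>
    rcases List.append_eq_append_iff.1 hl with ⟨as, rfl, h⟩ | ⟨bs, rfl, h⟩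
    · rw [List.append_assoc]
      exact node _ _ _ _ hC hl₁ (ih₂ h)
    · cases bs with
      | nil =>
        rw [List.append_nil] at hl₁
        exact node _ _ _ _ hC hl₁ (ih₂ (l₁ := []) h.symm)
      | cons c bs =>
        obtain ⟨rfl, rfl⟩ := List.cons.inj h
        have := node _ _ _ _ hC (ih₁ rfl) hl₂
        simpa using this

theorem of_isTransitiveSeq (h : IsTransitiveSeq X l) : IsBisectionTree X l := by
  induction h with
  | single => exact leaf X
  | comp l₁ l₂ Y B _ hB ih => exact ih.replace rfl hB

/-- The bisections of the tree are performed in place; the arbitrary context l₁, l₂ lets the right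
subtree be expanded after the left one. -/
theorem substitute {W : Set (TraceMonoid θ)} (h : IsBisectionTree X l)
    {l₁ l₂ : List (Set (TraceMonoid θ))} (hs : IsTransitiveSeq W (l₁ ++ X :: l₂)) :
    IsTransitiveSeq W (l₁ ++ l ++ l₂) := by
  induction h generalizing l₁ l₂ with
  | leaf X => simpa using hs
  | node X B l m hB _ _ ih₁ ih₂ =>
    have h₁ := ih₁ (hs.comp _ _ _ _ hB)
    have h₂ := ih₂ h₁
    simpa using h₂

theorem isTransitiveSeq (h : IsBisectionTree X l) : IsTransitiveSeq X l := by
  simpa using h.substitute (l₁ := []) (l₂ := []) IsTransitiveSeq.single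

theorem isPCCode (h : IsBisectionTree X l) (hX : IsPCCode X) : ∀ Y ∈ l, IsPCCode Y := by
  induction h with
  | leaf => simpa using hX
  | node X B l m hB _ _ ih₁ ih₂ =>
    intro Y hY
    rcases List.mem_append.1 hY with hY | hY
    exacts [ih₁ (hX.mono hB.1) Y hY, ih₂ hB.2 Y hY]

theorem closureProd_eq (hθ : ∀ a b, θ a b → θ b a) (h : IsBisectionTree X l)
    (hX : IsPCCode X) : closureProd l = Submonoid.closure X := by
  induction h with
  | leaf => exact closureProd_singleton _
  | node X B l m hB _ _ ih₁ ih₂ =>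
    rw [closureProd_append, ih₁ (hX.mono hB.1), ih₂ hB.2]
    apply Set.Subset.antisymm
    · rintro _ ⟨b, hb, r, hr, rfl⟩
      exact mul_mem (Submonoid.closure_mono hB.1 hb) ((hX.mem_closure_beta_iff hθ hB.1).1 hr).1
    · intro t ht
      exact hX.exists_mul_eq hθ hB.1 ht

/-- A transitive bisection refined by a transitive sequence splits it into transitive
sequences. -/
theorem split (hθ : ∀ a b, θ a b → θ b a) (h : IsBisectionTree X l) (hX : IsPCCode X)
    {B : Set (TraceMonoid θ)} (hB : IsTFSA X B) {l₁ l₂ : List (Set (TraceMonoid θ))}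
    (hl : l = l₁ ++ l₂) (h₁ : l₁ ≠ []) (h₂ : l₂ ≠ [])
    (hp : closureProd l₁ = Submonoid.closure B) :
    IsBisectionTree B l₁ ∧ IsBisectionTree (beta X B) l₂ := by
  induction h generalizing l₁ l₂ B with
  | leaf X =>
    rcases List.append_eq_singleton_iff.1 hl.symm with ⟨rfl, -⟩ | ⟨-, rfl⟩
    exacts [absurd rfl h₁, absurd rfl h₂]
  | node X C L M hC hL hM ihL ihM =>
    have hCc := hX.mono hC.1
    have hBc := hX.mono hB.1
    have hLp := hL.closureProd_eq hθ hCc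
    have hMp := hM.closureProd_eq hθ hC.2
    have hsub : ∀ {S T : Set (TraceMonoid θ)}, S ⊆ X → T ⊆ X →
        (Submonoid.closure S : Set (TraceMonoid θ)) ⊆ Submonoid.closure T → S ⊆ T :=
      fun hS hT h s hs => hX.mem_of_mem_closure hT (hS hs) (h (Submonoid.subset_closure hs))
    have cut : L = l₁ → M = l₂ → IsBisectionTree B l₁ ∧ IsBisectionTree (beta X B) l₂ := by
      rintro rfl rfl
      have e := hLp.symm.trans hp
      obtain rfl : C = B := Set.Subset.antisymm (hsub hC.1 hB.1 e.subset)
        (hsub hB.1 hC.1 e.superset)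
      exact ⟨hL, hM⟩
    rcases List.append_eq_append_iff.1 hl with ⟨as, rfl, rfl⟩ | ⟨bs, rfl, rfl⟩
    -- The cut is not before the end of the left subtree, so C ⊆ B. If it is inside the right
    -- subtree, that one splits along (β_{B-C}(C), β_{X-B}(B)); its first piece joins the left
    -- subtree to form the tree over B.
    · by_cases has : as = []
      · subst has
        exact cut (List.append_nil _).symm rfl
      rw [closureProd_append, hLp] at hp
      have hCB : C ⊆ B := hsub hC.1 hB.1 fun t ht =>
        hp.subset (Set.mem_mul.2 ⟨t, ht, 1, one_mem_closureProd _, mul_one t⟩)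
      have hββ := hX.beta_beta hθ hB.1 hCB hC.2
      have hβ : IsTFSA (beta X C) (beta B C) :=
        ⟨hX.beta_subset_beta hB.1, by rw [hββ]; exact hB.2⟩
      have hC' : IsTFSA B C := ⟨hCB, hC.2.mono hβ.1⟩
      -- Both sides equal ⟨B⟩ ∩ ⟨β_{X-C}(C)⟩.
      have hpa : closureProd as = Submonoid.closure (beta B C) := by
        ext t
        rw [SetLike.mem_coe, hBc.mem_closure_beta_iff hθ hCB, hX.remainder_eq_inter hB.1 hCB]
        constructor
        · intro ht
          refine ⟨(hX.mem_closure_beta_iff hθ hC.1).1 ?_, ?_⟩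
          · rw [← SetLike.mem_coe, ← hMp, closureProd_append]
            exact Set.mem_mul.2 ⟨t, ht, 1, one_mem_closureProd _, mul_one t⟩
          · rw [← SetLike.mem_coe, ← hp]
            exact Set.mem_mul.2 ⟨1, one_mem _, t, ht, one_mul t⟩
        · rintro ⟨ht, htB⟩
          rw [← SetLike.mem_coe, ← hp] at htB
          obtain ⟨c, hc, s, hs, rfl⟩ := htB
          have hsX : s ∈ Submonoid.closure X := by
            have : s ∈ closureProd (as ++ l₂) := by
              rw [closureProd_append]
              exact Set.mem_mul.2 ⟨s, hs, 1, one_mem_closureProd _, mul_one s⟩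
            rw [hMp] at this
            exact ((hX.mem_closure_beta_iff hθ hC.1).1 this).1
          rcases IsPCCode.eq_one_or_exists_mul hc with rfl | ⟨x, hx, u, hu, rfl⟩
          · simpa using hs
          · exact absurd (mul_assoc _ _ _)
              (ht.2 x hx (u * s) (mul_mem (Submonoid.closure_mono hC.1 hu) hsX))
      obtain ⟨k₁, k₂⟩ := ihM hC.2 hβ rfl has h₂ hpa
      rw [hββ] at k₂
      exact ⟨node _ _ _ _ hC' hL k₁, k₂⟩
    -- Symmetrically B ⊆ C: the left subtree splits along (B, β_{C-B}(B)), and its second piece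
    -- joins the right subtree to form the tree over β_{X-B}(B).
    · by_cases hbs : bs = []
      · subst hbs
        exact cut (List.append_nil _) rfl
      rw [closureProd_append, hp] at hLp
      have hBC : B ⊆ C := hsub hB.1 hC.1 fun t ht =>
        hLp.subset (Set.mem_mul.2 ⟨t, ht, 1, one_mem_closureProd _, mul_one t⟩)
      have hββ := hX.beta_beta hθ hC.1 hBC hB.2
      have hsB : beta C B ⊆ beta X B := hX.beta_subset_beta hC.1
      obtain ⟨k₁, k₂⟩ := ihL hCc ⟨hBC, hB.2.mono hsB⟩ rfl h₁ hbs hp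
      refine ⟨k₁, node _ (beta C B) _ _ ⟨hsB, by rw [hββ]; exact hC.2⟩ k₂ ?_⟩
      rwa [hββ]

/-- If a transitive sequence refines another one, then its segments are transitive sequences. -/
theorem forall₂_of_flatten (hθ : ∀ a b, θ a b → θ b a) (h : IsBisectionTree X l)
    (hX : IsPCCode X) {L : List (List (Set (TraceMonoid θ)))}
    (hL : List.Forall₂ (fun Y m => closureProd m = Submonoid.closure Y ∧ m ≠ []) l L)
    (hf : IsBisectionTree X L.flatten) : List.Forall₂ IsBisectionTree l L := by
  have key : ∀ {l : List (Set (TraceMonoid θ))} {L : List (List (Set (TraceMonoid θ)))},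
      List.Forall₂ (fun Y m => closureProd m = Submonoid.closure Y ∧ m ≠ []) l L →
      closureProd L.flatten = closureProd l ∧ (l ≠ [] → L.flatten ≠ []) := by
    intro l L hL
    induction hL with
    | nil => simp
    | cons h _ ih =>
      rw [List.flatten_cons, closureProd_append, h.1, ih.1, ← closureProd_singleton,
        ← closureProd_append]
      exact ⟨rfl, fun _ => by simp [h.2]⟩
  induction h generalizing L with
  | leaf X =>
    obtain ⟨m, L', hm, hL', rfl⟩ := List.forall₂_cons_left_iff.1 hL
    obtain rfl := List.forall₂_nil_left_iff.1 hL'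
    simpa using hf
  | node X B l m hB hl hm ih₁ ih₂ =>
    have k₁ := List.forall₂_take l.length hL
    have k₂ := List.forall₂_drop l.length hL
    rw [List.take_left] at k₁
    rw [List.drop_left] at k₂
    rw [← List.take_append_drop l.length L] at hf ⊢
    rw [List.flatten_append] at hf
    -- The root bisection of the coarse tree splits the fine tree.
    obtain ⟨h₁, h₂⟩ := hf.split hθ hX hB rfl ((key k₁).2 hl.ne_nil) ((key k₂).2 hm.ne_nil)
      ((key k₁).1.trans (hl.closureProd_eq hθ (hX.mono hB.1)))
    exact List.rel_append (ih₁ (hX.mono hB.1) k₁ h₁) (ih₂ hB.2 k₂ h₂)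

/-- Empty alphabets may be inserted into a transitive sequence. -/
theorem insert_empty (hθ : ∀ a b, θ a b → θ b a) (hX : IsPCCode X)
    {l₁ l₂ : List (Set (TraceMonoid θ))} (h : IsBisectionTree X (l₁ ++ l₂)) :
    IsBisectionTree X (l₁ ++ ∅ :: l₂) := by
  cases l₂ with
  -- Before a term Y, use the bisection (∅, Y) of Y.
  | cons Y l₂ =>
    have hY := h.isPCCode hX Y (by simp)
    have he := hY.beta_empty hθ
    simpa [he] using h.replace rfl ⟨Set.empty_subset Y, by rwa [he]⟩
  -- At the end of the sequence, use the bisection (Y, ∅) of its last term.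
  | nil =>
    rcases List.eq_nil_or_concat l₁ with rfl | ⟨l, Y, rfl⟩
    · exact absurd rfl h.ne_nil
    · have hY := h.isPCCode hX Y (by simp)
      have := h.replace (l₁ := l) (l₂ := []) (Y := Y) (B := Y) (by simp)
        ⟨Set.Subset.rfl, by rw [beta_self]; exact hY.mono (Set.empty_subset Y)⟩
      simpa [beta_self] using this

/-- Passing from q to p only adds empty alphabets, inserted one at a time; l₁ holds the part already
treated. -/
theorem filter_of_imp (hθ : ∀ a b, θ a b → θ b a) (hX : IsPCCode X) {ι : Type*}
    {f : ι → Set (TraceMonoid θ)} {p q : ι → Bool} (hqp : ∀ j, q j → p j)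
    (hpq : ∀ j, p j → ¬ q j → f j = ∅) {L : List ι} {l₁ : List (Set (TraceMonoid θ))}
    (h : IsBisectionTree X (l₁ ++ (L.filter q).map f)) :
    IsBisectionTree X (l₁ ++ (L.filter p).map f) := by
  induction L generalizing l₁ with
  | nil => simpa using h
  | cons j L ih =>
    by_cases hq : q j
    · rw [List.filter_cons_of_pos hq, List.map_cons, ← List.singleton_append,
        ← List.append_assoc] at h
      rw [List.filter_cons_of_pos (hqp j hq), List.map_cons, ← List.singleton_append,
        ← List.append_assoc]
      exact ih h
    · rw [List.filter_cons_of_neg hq] at h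
      by_cases hp : p j
      · rw [List.filter_cons_of_pos hp, List.map_cons, hpq j hp hq, ← List.singleton_append,
          ← List.append_assoc]
        apply ih
        simpa using insert_empty hθ hX h
      · rw [List.filter_cons_of_neg hp]
        exact ih h

end IsBisectionTree

end TraceMonoid

/-! ### Ordered families as decreasing lists -/

section ListIndexing

variable {J : Type*} [LinearOrder J]

theorem exists_pairwise_gt_list {n : ℕ} (e : (Fin n)ᵒᵈ ≃o J) :
    (List.ofFn fun k => e (OrderDual.toDual k)).Pairwise (· > ·) ∧
      ∀ j, j ∈ List.ofFn fun k => e (OrderDual.toDual k) := by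
  refine ⟨List.pairwise_ofFn.2 fun i j hij => e.lt_iff_lt.2 hij, fun j => ?_⟩
  exact (List.mem_ofFn' _ _).2 ⟨OrderDual.ofDual (e.symm j), by simp⟩

theorem exists_orderIso_of_pairwise_gt {S : Type*} (Y : J → S) {L : List J}
    (hL : L.Pairwise (· > ·)) (hmem : ∀ j, j ∈ L) :
    ∃ e : (Fin (L.map Y).length)ᵒᵈ ≃o J,
      ∀ k : Fin (L.map Y).length, Y (e (OrderDual.toDual k)) = (L.map Y).get k := by
  let f : (Fin (L.map Y).length)ᵒᵈ → J := fun k => L.get ((OrderDual.ofDual k).cast (List.length_map _))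
  have hf : StrictMono f := fun a b hab => List.pairwise_iff_get.1 hL _ _ hab
  have hs : Function.Surjective f := fun j => by
    obtain ⟨k, hk⟩ := List.get_of_mem (hmem j)
    exact ⟨OrderDual.toDual (k.cast (List.length_map _).symm), hk⟩
  refine ⟨hf.orderIsoOfSurjective f hs, fun k => ?_⟩
  simp [f]

/-- By monotonicity the fibres of φ form consecutive blocks, so both sides are strictly decreasing
lists with the same members. -/
theorem flatten_map_filter_eq {J' : Type*} [LinearOrder J'] {φ : J' → J} (hφ : Monotone φ)
    {L : List J} {L' : List J'} (hL : L.Pairwise (· > ·)) (hmem : ∀ j, j ∈ L)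
    (hL' : L'.Pairwise (· > ·)) :
    (L.map fun i => L'.filter fun j => φ j = i).flatten = L' := by
  refine List.Pairwise.eq_of_mem_iff (r := (· > ·)) (List.pairwise_flatten.2 ⟨?_, ?_⟩) hL' ?_
  · intro l hl
    obtain ⟨i, -, rfl⟩ := List.mem_map.1 hl
    exact hL'.filter _
  · refine List.pairwise_map.2 (hL.imp fun {a b} hab x hx y hy => ?_)
    simp only [List.mem_filter, decide_eq_true_eq] at hx hy
    by_contra hxy
    have := hφ (not_lt.1 hxy)
    rw [hx.2, hy.2] at this
    exact absurd hab (not_lt.2 this)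
  · intro j
    simp [hmem]

end ListIndexing

theorem IsDecomposition.map {M : Type*} [Monoid M] {J J' : Type*} [LinearOrder J] [LinearOrder J']
    {F : J → Submonoid M} {F' : J' → Submonoid M} {f : J → J'} (hf : StrictMono f)
    (hF : ∀ j, F j ≤ F' (f j)) {m : M} {d : List (J × M)} (hd : IsDecomposition F m d) :
    IsDecomposition F' m (d.map (Prod.map f id)) := by
  obtain ⟨h₁, h₂, h₃⟩ := hd
  refine ⟨List.pairwise_map.2 (h₁.imp fun h => hf h), ?_, ?_⟩
  · intro p hp
    obtain ⟨q, hq, rfl⟩ := List.mem_map.1 hp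
    exact ⟨hF _ (h₂ q hq).1, (h₂ q hq).2⟩
  · rw [← h₃, List.map_map]
    rfl

/-- Otherwise m would have two distinct one-term decompositions. -/
theorem IsFactorization.eq_of_mem {M : Type*} [Monoid M] {J : Type*} [LinearOrder J]
    {N : Submonoid M} {F : J → Submonoid M} (hF : IsFactorization N F) {i j : J} {m : M}
    (hm : m ≠ 1) (hi : m ∈ F i) (hj : m ∈ F j) : i = j := by
  have hd : ∀ k, m ∈ F k → IsDecomposition F m [(k, m)] := fun k hk =>
    ⟨List.pairwise_singleton _ _, by simpa using ⟨hk, hm⟩, by simp⟩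
  have := (hF.2 m (hF.1 i hi) hm).unique (hd i hi) (hd j hj)
  simpa using this

namespace TraceMonoid

variable {A : Type*} {θ : A → A → Prop}

/-- Indices of L absent from the decomposition contribute the factor 1. -/
theorem prod_mem_closureProd {J : Type*} [LinearOrder J] {Y : J → Set (TraceMonoid θ)}
    {L : List J} (hL : L.Pairwise (· > ·)) {d : List (J × TraceMonoid θ)}
    (hd : d.Pairwise fun p q => p.1 > q.1)
    (hmem : ∀ p ∈ d, p.1 ∈ L ∧ p.2 ∈ Submonoid.closure (Y p.1)) :
    (d.map Prod.snd).prod ∈ closureProd (L.map Y) := by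
  induction L generalizing d with
  | nil =>
    cases d with
    | nil => exact one_mem_closureProd _
    | cons p d => simpa using (hmem p (by simp)).1
  | cons j L ih =>
    rw [List.map_cons, ← List.singleton_append, closureProd_append, closureProd_singleton]
    rw [List.pairwise_cons] at hL
    cases d with
    | nil => exact Set.mem_mul.2 ⟨1, one_mem _, 1, one_mem_closureProd _, one_mul 1⟩
    | cons p d =>
      rw [List.pairwise_cons] at hd
      by_cases hp : p.1 = j
      · refine Set.mem_mul.2 ⟨p.2, hp ▸ (hmem p (by simp)).2, _, ih hL.2 hd.2 fun q hq => ?_, by simp⟩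
        have hq' := hmem q (List.mem_cons_of_mem _ hq)
        refine ⟨(List.mem_cons.1 hq'.1).resolve_left ?_, hq'.2⟩
        exact fun h => absurd (hd.1 q hq) (by simp [h, hp])
      · refine Set.mem_mul.2 ⟨1, one_mem _, _, ih hL.2 (List.pairwise_cons.2 hd) fun q hq => ?_,
          one_mul _⟩
        have hq' := hmem q hq
        have hpL := (List.mem_cons.1 (hmem p (by simp)).1).resolve_left hp
        refine ⟨(List.mem_cons.1 hq'.1).resolve_left fun h => ?_, hq'.2⟩
        rcases List.mem_cons.1 hq with rfl | hqd
        · exact hp h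
        · exact absurd (lt_trans (hd.1 q hqd) (hL.1 _ hpL)) (by simp [h])

theorem closureProd_subset {N : Submonoid (TraceMonoid θ)} {l : List (Set (TraceMonoid θ))}
    (h : ∀ Y ∈ l, Submonoid.closure Y ≤ N) : closureProd l ⊆ N := by
  induction l with
  | nil => simp [closureProd]
  | cons Y l ih =>
    rw [← List.singleton_append, closureProd_append, closureProd_singleton]
    rintro _ ⟨a, ha, b, hb, rfl⟩
    exact mul_mem (h Y (by simp) ha) (ih (fun Z hZ => h Z (List.mem_cons_of_mem _ hZ)) hb)

/-- Existence comes from the smaller subfamily given by p, uniqueness from the ambient factorization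
of M. -/
theorem isFactorization_restrict {J' : Type*} [LinearOrder J'] {Y' : J' → Set (TraceMonoid θ)}
    {M N : Submonoid (TraceMonoid θ)} (hNM : N ≤ M)
    (hY' : IsFactorization M fun j => Submonoid.closure (Y' j)) {p : J' → Prop}
    (hp : IsFactorization N fun j : {j // p j} => Submonoid.closure (Y' j.1)) :
    IsFactorization N fun k => Submonoid.closure (restrict Y' N k) := by
  refine ⟨fun k => k.2, fun m hm h₁ => ?_⟩
  obtain ⟨d, hd, -⟩ := hp.2 m hm h₁
  let f : {j // p j} → RestrictIndex Y' N := fun j => ⟨j.1, hp.1 j⟩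
  have hf : StrictMono f := fun _ _ h => h
  have hex : IsDecomposition (fun k => Submonoid.closure (restrict Y' N k)) m
      (d.map (Prod.map f id)) := hd.map hf fun _ => le_rfl
  have key : ∀ c : List (RestrictIndex Y' N × TraceMonoid θ),
      IsDecomposition (fun k => Submonoid.closure (restrict Y' N k)) m c →
      IsDecomposition (fun j => Submonoid.closure (Y' j)) m
        (c.map (Prod.map Subtype.val id)) :=
    fun c hc => hc.map (F' := fun j => Submonoid.closure (Y' j)) (f := Subtype.val)
      (fun _ _ h => h) fun _ => le_rfl
  have hinj : Function.Injective
      (Prod.map Subtype.val id : RestrictIndex Y' N × TraceMonoid θ → J' × TraceMonoid θ) :=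
    Function.Injective.prodMap Subtype.val_injective Function.injective_id
  exact existsUnique_of_exists_of_unique ⟨_, hex⟩ fun d₁ d₂ h₁' h₂' =>
    List.map_injective_iff.2 hinj ((hY'.2 m (hNM hm) h₁).unique (key d₁ h₁') (key d₂ h₂'))

end TraceMonoid

/-! ### The main theorem -/

open TraceMonoid in
theorem mainTheorem8 {A : Type*} (θ : A → A → Prop)
    (hirrefl : ∀ a, ¬ θ a a) (hsymm : ∀ a b, θ a b → θ b a)
    {J J' : Type*} [LinearOrder J] [LinearOrder J']
    (Y : J → Set (TraceMonoid θ)) (Y' : J' → Set (TraceMonoid θ))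
    (hY : TraceMonoid.IsTransitiveFactorization (TraceMonoid.letters θ) Y)
    (hY' : TraceMonoid.IsTransitiveFactorization (TraceMonoid.letters θ) Y')
    (hYY' : IsRefinedBy (fun i => Submonoid.closure (Y i))
      (fun j => Submonoid.closure (Y' j))) :
    ∀ i : J, TraceMonoid.IsTransitiveFactorization (Y i)
      (TraceMonoid.restrict Y' (Submonoid.closure (Y i))) := by
  classical
  obtain ⟨hX, hF, l, hl, e, he⟩ := hY
  obtain ⟨-, hF', l', hl', e', he'⟩ := hY'
  obtain ⟨φ, hφ, hφs, hφF⟩ := hYY'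
  obtain ⟨hL, hLm⟩ := exists_pairwise_gt_list e
  obtain ⟨hL', hLm'⟩ := exists_pairwise_gt_list e'
  have hLY : (List.ofFn fun k => e (OrderDual.toDual k)).map Y = l := by
    rw [List.map_ofFn]
    exact (congrArg List.ofFn (funext he)).trans (List.ofFn_get l)
  have hLY' : (List.ofFn fun k => e' (OrderDual.toDual k)).map Y' = l' := by
    rw [List.map_ofFn]
    exact (congrArg List.ofFn (funext he')).trans (List.ofFn_get l')
  generalize (List.ofFn fun k => e (OrderDual.toDual k)) = L at hL hLm hLY
  generalize (List.ofFn fun k => e' (OrderDual.toDual k)) = L' at hL' hLm' hLY'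
  clear e he e' he'
  subst hLY hLY'
  have hT := IsBisectionTree.of_isTransitiveSeq hl
  have hT' := IsBisectionTree.of_isTransitiveSeq hl'
  -- Each block φ⁻¹(i), in decreasing order, is the leaf list of a tree over Y_i.
  have hseg : List.Forall₂ IsBisectionTree (L.map Y)
      (L.map fun i => (L'.filter fun j => φ j = i).map Y') := by
    refine hT.forall₂_of_flatten hsymm hX ?_ ?_
    · rw [List.forall₂_map_left_iff, List.forall₂_map_right_iff, List.forall₂_same]
      intro i _
      refine ⟨Set.Subset.antisymm (closureProd_subset ?_) fun m hm => ?_, ?_⟩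
      · simp only [List.mem_map, List.mem_filter, decide_eq_true_eq]
        rintro _ ⟨j, ⟨-, hj⟩, rfl⟩
        exact (hφF i).1 ⟨j, hj⟩
      · by_cases h₁ : m = 1
        · exact h₁ ▸ one_mem_closureProd _
        obtain ⟨d, hd, -⟩ := (hφF i).2 m hm h₁
        have hd' := hd.map (F' := fun j => Submonoid.closure (Y' j))
          (Subtype.strictMono_coe _) fun _ => le_rfl
        rw [← hd'.2.2]
        refine prod_mem_closureProd (hL'.filter _) hd'.1 fun q hq => ⟨?_, (hd'.2.1 q hq).1⟩
        obtain ⟨r, -, rfl⟩ := List.mem_map.1 hq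
        simpa [hLm'] using r.1.2
      · obtain ⟨j, hj⟩ := hφs i
        exact List.ne_nil_of_mem (List.mem_map_of_mem (List.mem_filter.2 ⟨hLm' j, by simpa using hj⟩))
    · have := congrArg (List.map Y') (flatten_map_filter_eq hφ hL hLm hL')
      rw [List.map_flatten, List.map_map] at this
      exact this.symm ▸ hT'
  rw [List.forall₂_map_left_iff, List.forall₂_map_right_iff, List.forall₂_same] at hseg
  intro i
  have hYi : IsPCCode (Y i) := hT.isPCCode hX _ (List.mem_map_of_mem (hLm i))
  refine ⟨hYi, isFactorization_restrict (hF.1 i) hF' (hφF i), ?_⟩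
  have hfil := IsBisectionTree.filter_of_imp hsymm hYi (f := Y') (L := L') (l₁ := [])
    (p := fun j => decide (Submonoid.closure (Y' j) ≤ Submonoid.closure (Y i)))
    (q := fun j => decide (φ j = i))
    (fun j hj => by simpa using (hφF i).1 ⟨j, by simpa using hj⟩)
    (fun j hp hq => by
      simp only [decide_eq_true_eq] at hp hq
      -- An element x of Y'_j would be a nontrivial trace in both ⟨Y_{φ j}⟩ and ⟨Y_i⟩, forcing φ j =
      -- i.
      refine Set.eq_empty_of_forall_notMem fun x hx => hq ?_
      have hx₁ : x ≠ 1 := fun h =>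
        (hT'.isPCCode hX _ (List.mem_map_of_mem (hLm' j))).one_notMem (h ▸ hx)
      exact hF.eq_of_mem hx₁ ((hφF (φ j)).1 ⟨j, rfl⟩ (Submonoid.subset_closure hx))
        (hp (Submonoid.subset_closure hx)))
    (by simpa using hseg i (hLm i))
  have hK : ∀ j ∈ L'.filter fun j => decide (Submonoid.closure (Y' j) ≤ Submonoid.closure (Y i)),
      Submonoid.closure (Y' j) ≤ Submonoid.closure (Y i) := fun j hj => by
    simpa using (List.mem_filter.1 hj).2
  let K : List (RestrictIndex Y' (Submonoid.closure (Y i))) := List.attachWith _ _ hK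
  have hKv : K.map Subtype.val = L'.filter fun j =>
      decide (Submonoid.closure (Y' j) ≤ Submonoid.closure (Y i)) :=
    List.attachWith_map_subtype_val _
  have hKY : K.map (restrict Y' (Submonoid.closure (Y i))) = (L'.filter fun j =>
      decide (Submonoid.closure (Y' j) ≤ Submonoid.closure (Y i))).map Y' := by
    rw [← hKv, List.map_map]
    rfl
  refine ⟨_, ?_, exists_orderIso_of_pairwise_gt _ (L := K) ?_ ?_⟩
  · rw [hKY]
    exact hfil.isTransitiveSeq
  · have hp := hL'.filter fun j => decide (Submonoid.closure (Y' j) ≤ Submonoid.closure (Y i))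
    rw [← hKv, List.pairwise_map] at hp
    exact hp
  · intro k
    refine (List.mem_attachWith ..).2 (List.mem_filter.2 ⟨hLm' k.1, ?_⟩)
    exact decide_eq_true k.2
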